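/- Let $\mathsf H$ be the free symmetric strict monoidal category generated by a commutative Hopf monoid. Its objects are the natural numbers $n\ge 0$ ($n$ stands for the $n$-th tensor power of the generating object $1$, so $m\otimes n=m+n$ and $0$ is the unit object). Its morphisms are obtained by composition and tensor product from identities, symmetries $P_{m,n}\colon m+n\to n+m$ and the structure morphisms $\mu\colon 2\to1$, $\eta\colon 0\to 1$, $\Delta\colon 1\to2$, $\epsilon\colon 1\to 0$, $S\colon 1\to 1$, subject only to the axioms of a symmetric strict monoidal category and of a commutative Hopf monoid (associativity and unitality of $\mu,\eta$; coassociativity and counitality of $\Delta,\epsilon$; $\epsilon\eta=1_0$, $\epsilon\mu=\epsilon\otimes\epsilon$, $\Delta\eta=\eta\otimes\eta$, $\Delta\mu=(\mu\otimes\mu)(1_1\otimes P_{1,1}\otimes 1_1)(\Delta\otimes\Delta)$; $\mu(1_1\otimes S)\Delta=\mu(S\otimes 1_1)\Delta=\eta\epsilon$; $\mu P_{1,1}=\mu$). Write $1_n$ for the identity of $n$. Put $\eta_n=\eta^{\otimes n}\colon 0\to n$ and $\epsilon_n=\epsilon^{\otimes n}\colon n\to 0$. Define $\mu_n\colon n+n\to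 n$ by $\mu_0=1_0$, $\mu_{n+1}=(\mu_n\otimes\mu)(1_n\otimes P_{1,n}\otimes 1_1)$, and $\Delta_n\colon n\to n+n$ by $\Delta_0=1_0$, $\Delta_{n+1}=(1_n\otimes P_{n,1}\otimes 1_1)(\Delta_n\otimes\Delta)$. Let $\mathsf H(m,n)_{\mathrm{conv}}$ be the set $\mathsf H(m,n)$ of morphisms $m\to n$ with the convolution product $f*g=\mu_n(f\otimes g)\Delta_m$ and the element $\eta_n\epsilon_m$. For $f\colon m\to n$ and $f'\colon m'\to n$ put $f\vee f'=\mu_n(f\otimes f')\colon m+m'\to n$. **Proposition.** The category $\mathsf H$ admits finite coproducts. More precisely, the object $0$ is initial, and for all $m,m'\ge 0$ the object $m+m'$ is a coproduct of $m$ and $m'$, with injections $$m\xrightarrow{\;1_m\otimes\eta_{m'}\;}m+m'\xleftarrow{\;\eta_m\otimes 1_{m'}\;}m'.$$ Moreover, for all $m,n\ge 0$, $\mathsf H(m,n)_{\mathrm{conv}}$ is a group with unit $\eta_n\epsilon_m$, and there is a group isomorphism $$\mathsf H(m,n)_{\mathrm{conv}}\;\cong\;\mathsf H(1,n)_{\mathrm{conv}}^{\,m}$$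 whose inverse is $(w_1,\dots,w_m)\mapsto w_1\vee\cdots\vee w_m$ (which is $\eta_n$ when $m=0$). -/

import Mathlib

open CategoryTheory CategoryTheory.Limits

namespace HopfPROP

/-- Formal morphism expressions `m → n` (the object `n` stands for the `n`-th tensor power of the
generating object) built from identities, symmetries and the five structure morphisms of a Hopf
monoid by composition and tensor product.  `comp f g` is "first `f`, then `g`". -/
inductive Term : ℕ → ℕ → Type
  | id (n : ℕ) : Term n n
  | comp {l m n : ℕ} (f : Term l m) (g : Term m n) : Term l n
  | tensor {m n m' n' : ℕ} (f : Term m n) (g : Term m' n') : Term (m + m') (n + n')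
  | symm (m n : ℕ) : Term (m + n) (n + m)
  | mul : Term 2 1
  | unit : Term 0 1
  | comul : Term 1 2
  | counit : Term 1 0
  | antipode : Term 1 1

/-- Transport of an expression along equalities of its source and target. -/
def Term.cast {m n m' n' : ℕ} (hm : m = m') (hn : n = n') (f : Term m n) : Term m' n' :=
  hn ▸ hm ▸ f

/-- The smallest congruence on expressions that contains the axioms of a symmetric strict monoidal
category and of a commutative Hopf monoid. -/
inductive Rel : {m n : ℕ} → Term m n → Term m n → Prop
  -- it is an equivalence relation, compatible with both operations
  | refl {m n : ℕ} (f : Term m n) : Rel f f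
  | symm {m n : ℕ} {f g : Term m n} : Rel f g → Rel g f
  | trans {m n : ℕ} {f g h : Term m n} : Rel f g → Rel g h → Rel f h
  | comp_congr {l m n : ℕ} {f f' : Term l m} {g g' : Term m n} :
      Rel f f' → Rel g g' → Rel (f.comp g) (f'.comp g')
  | tensor_congr {m n m' n' : ℕ} {f f' : Term m n} {g g' : Term m' n'} :
      Rel f f' → Rel g g' → Rel (f.tensor g) (f'.tensor g')
  -- category
  | id_comp {m n : ℕ} (f : Term m n) : Rel ((Term.id m).comp f) f
  | comp_id {m n : ℕ} (f : Term m n) : Rel (f.comp (Term.id n)) f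
  | assoc {k l m n : ℕ} (f : Term k l) (g : Term l m) (h : Term m n) :
      Rel ((f.comp g).comp h) (f.comp (g.comp h))
  -- the tensor product is a functor
  | tensor_id (m n : ℕ) : Rel ((Term.id m).tensor (Term.id n)) (Term.id (m + n))
  | tensor_comp {l m n l' m' n' : ℕ} (f : Term l m) (g : Term m n)
      (f' : Term l' m') (g' : Term m' n') :
      Rel ((f.comp g).tensor (f'.comp g')) ((f.tensor f').comp (g.tensor g'))
  -- the tensor product is strictly associative and unital
  | tensor_assoc {m n m' n' m'' n'' : ℕ} (f : Term m n) (g : Term m' n') (h : Term m'' n'') :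
      Rel (((f.tensor g).tensor h).cast (Nat.add_assoc m m' m'') (Nat.add_assoc n n' n''))
        (f.tensor (g.tensor h))
  | unit_tensor {m n : ℕ} (f : Term m n) :
      Rel (((Term.id 0).tensor f).cast (Nat.zero_add m) (Nat.zero_add n)) f
  | tensor_unit {m n : ℕ} (f : Term m n) :
      Rel ((f.tensor (Term.id 0)).cast (Nat.add_zero m) (Nat.add_zero n)) f
  -- symmetry: naturality, involutivity, hexagon
  | symm_natural {m n m' n' : ℕ} (f : Term m n) (g : Term m' n') :
      Rel ((f.tensor g).comp (Term.symm n n')) ((Term.symm m m').comp (g.tensor f))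
  | symm_symm (m n : ℕ) : Rel ((Term.symm m n).comp (Term.symm n m)) (Term.id (m + n))
  | hexagon (l m n : ℕ) :
      Rel (Term.symm (l + m) n)
        ((((Term.id l).tensor (Term.symm m n)).cast
            (Nat.add_assoc l m n).symm (Nat.add_assoc l n m).symm).comp
          (((Term.symm l n).tensor (Term.id m)).cast rfl (Nat.add_assoc n l m)))
  -- monoid
  | mul_assoc : Rel ((Term.mul.tensor (Term.id 1)).comp Term.mul)
      (((Term.id 1).tensor Term.mul).comp Term.mul)
  | unit_mul : Rel ((Term.unit.tensor (Term.id 1)).comp Term.mul) (Term.id 1)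
  | mul_unit : Rel (((Term.id 1).tensor Term.unit).comp Term.mul) (Term.id 1)
  -- comonoid
  | comul_assoc : Rel (Term.comul.comp (Term.comul.tensor (Term.id 1)))
      (Term.comul.comp ((Term.id 1).tensor Term.comul))
  | counit_comul : Rel (Term.comul.comp (Term.counit.tensor (Term.id 1))) (Term.id 1)
  | comul_counit : Rel (Term.comul.comp ((Term.id 1).tensor Term.counit)) (Term.id 1)
  -- bimonoid
  | unit_counit : Rel (Term.unit.comp Term.counit) (Term.id 0)
  | mul_counit : Rel (Term.mul.comp Term.counit) (Term.counit.tensor Term.counit)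
  | unit_comul : Rel (Term.unit.comp Term.comul) (Term.unit.tensor Term.unit)
  | mul_comul : Rel (Term.mul.comp Term.comul)
      ((Term.comul.tensor Term.comul).comp
        ((((Term.id 1).tensor (Term.symm 1 1)).tensor (Term.id 1)).comp
          (Term.mul.tensor Term.mul)))
  -- antipode
  | antipode_right :
      Rel (Term.comul.comp (((Term.id 1).tensor Term.antipode).comp Term.mul))
        (Term.counit.comp Term.unit)
  | antipode_left :
      Rel (Term.comul.comp ((Term.antipode.tensor (Term.id 1)).comp Term.mul))
        (Term.counit.comp Term.unit)
  -- commutativity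
  | mul_comm : Rel ((Term.symm 1 1).comp Term.mul) Term.mul

/-- The equivalence relation `Rel` as a setoid. -/
instance termSetoid (m n : ℕ) : Setoid (Term m n) where
  r := Rel
  iseqv := ⟨Rel.refl, Rel.symm, Rel.trans⟩

/-- The set of morphisms `m → n`. -/
def Hom (m n : ℕ) : Type := Quotient (termSetoid m n)

namespace Hom

/-- The identity of `n`. -/
def id (n : ℕ) : Hom n n := Quotient.mk _ (Term.id n)

/-- Composition, in diagrammatic order: first `f`, then `g`. -/
def comp {l m n : ℕ} (f : Hom l m) (g : Hom m n) : Hom l n :=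
  Quotient.map₂ Term.comp (fun _ _ h _ _ h' => Rel.comp_congr h h') f g

/-- The tensor product of morphisms. -/
def tensor {m n m' n' : ℕ} (f : Hom m n) (g : Hom m' n') : Hom (m + m') (n + n') :=
  Quotient.map₂ Term.tensor (fun _ _ h _ _ h' => Rel.tensor_congr h h') f g

/-- The symmetry `P_{m,n}`. -/
def symm (m n : ℕ) : Hom (m + n) (n + m) := Quotient.mk _ (Term.symm m n)

/-- The multiplication `μ`. -/
def mul : Hom 2 1 := Quotient.mk _ Term.mul

/-- The unit `η`. -/
def unit : Hom 0 1 := Quotient.mk _ Term.unit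

/-- The comultiplication `Δ`. -/
def comul : Hom 1 2 := Quotient.mk _ Term.comul

/-- The counit `ε`. -/
def counit : Hom 1 0 := Quotient.mk _ Term.counit

/-- The antipode `S`. -/
def antipode : Hom 1 1 := Quotient.mk _ Term.antipode

/-- Transport of a morphism along equalities of its source and target. -/
def cast {m n m' n' : ℕ} (hm : m = m') (hn : n = n') (f : Hom m n) : Hom m' n' :=
  hn ▸ hm ▸ f

/-- The unit `η_n = η ⊗ ⋯ ⊗ η : 0 → n` of the monoid `n`. -/
def unitPow : (n : ℕ) → Hom 0 n
  | 0 => id 0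
  | n + 1 => (unitPow n).tensor unit

/-- The counit `ε_n = ε ⊗ ⋯ ⊗ ε : n → 0` of the comonoid `n`. -/
def counitPow : (n : ℕ) → Hom n 0
  | 0 => id 0
  | n + 1 => (counitPow n).tensor counit

/-- The multiplication `μ_n : n + n → n` of the monoid `n`:
`μ_0 = 1` and `μ_{n+1} = (μ_n ⊗ μ) ∘ (1_n ⊗ P_{1,n} ⊗ 1_1)`. -/
def mulPow : (n : ℕ) → Hom (n + n) n
  | 0 => id 0
  | n + 1 =>
      ((((id n).tensor (symm 1 n)).tensor (id 1)).cast
          (m' := (n + 1) + (n + 1)) (n' := (n + n) + 2) (by omega) (by omega)).comp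
        ((mulPow n).tensor mul)

/-- The comultiplication `Δ_n : n → n + n` of the comonoid `n`:
`Δ_0 = 1` and `Δ_{n+1} = (1_n ⊗ P_{n,1} ⊗ 1_1) ∘ (Δ_n ⊗ Δ)`. -/
def comulPow : (n : ℕ) → Hom n (n + n)
  | 0 => id 0
  | n + 1 =>
      ((comulPow n).tensor comul).comp
        ((((id n).tensor (symm n 1)).tensor (id 1)).cast
          (m' := (n + n) + 2) (n' := (n + 1) + (n + 1)) (by omega) (by omega))

/-- The operation `f ∨ g = μ_n ∘ (f ⊗ g)`. -/
def vee {m m' n : ℕ} (f : Hom m n) (g : Hom m' n) : Hom (m + m') n :=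
  (f.tensor g).comp (mulPow n)

/-- The iterated operation `w_1 ∨ ⋯ ∨ w_m` on morphisms `1 → n`; it is `η_n` for `m = 0`. -/
def iteratedVee {n : ℕ} : (m : ℕ) → (Fin m → Hom 1 n) → Hom m n
  | 0, _ => unitPow n
  | m + 1, w => (iteratedVee m (fun i => w i.castSucc)).vee (w (Fin.last m))

/-- The morphism `1_m ⊗ η_{m'} : m → m + m'`. -/
def inl (m m' : ℕ) : Hom m (m + m') :=
  ((id m).tensor (unitPow m')).cast (Nat.add_zero m) rfl

/-- The morphism `η_m ⊗ 1_{m'} : m' → m + m'`. -/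
def inr (m m' : ℕ) : Hom m' (m + m') :=
  ((unitPow m).tensor (id m')).cast (Nat.zero_add m') rfl

end Hom

/-- The set of morphisms `m → n`, equipped with convolution. -/
def Conv (m n : ℕ) : Type := Hom m n

/-- The convolution `f * g = μ_n ∘ (f ⊗ g) ∘ Δ_m`. -/
instance convMul (m n : ℕ) : Mul (Conv m n) where
  mul f g := (Hom.comulPow m).comp ((Hom.tensor f g).comp (Hom.mulPow n))

/-- The convolution unit `η_n ∘ ε_m`. -/
instance convOne (m n : ℕ) : One (Conv m n) where
  one := (Hom.counitPow m).comp (Hom.unitPow n)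

end HopfPROP

/-- The objects of the free symmetric strict monoidal category generated by a commutative Hopf
monoid: one object `⟨n⟩`, the `n`-th tensor power of the generator, for each natural number `n`. -/
structure HopfPROP where
  /-- The exponent. -/
  deg : ℕ

instance HopfPROP.category : Category HopfPROP where
  Hom X Y := HopfPROP.Hom X.deg Y.deg
  id X := HopfPROP.Hom.id X.deg
  comp f g := HopfPROP.Hom.comp f g
  id_comp f := Quotient.inductionOn f fun f => Quotient.sound (HopfPROP.Rel.id_comp f)
  comp_id f := Quotient.inductionOn f fun f => Quotient.sound (HopfPROP.Rel.comp_id f)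
  assoc f g h := Quotient.inductionOn₃ f g h fun f g h =>
    Quotient.sound (HopfPROP.Rel.assoc f g h)

/-- The morphism `1_m ⊗ η_{m'} : m → m + m'` of the category. -/
def HopfPROP.inl (m m' : ℕ) : (⟨m⟩ : HopfPROP) ⟶ ⟨m + m'⟩ := HopfPROP.Hom.inl m m'

/-- The morphism `η_m ⊗ 1_{m'} : m' → m + m'` of the category. -/
def HopfPROP.inr (m m' : ℕ) : (⟨m'⟩ : HopfPROP) ⟶ ⟨m + m'⟩ := HopfPROP.Hom.inr m m'

namespace HopfPROP

/-! ### The symmetric monoidal structure -/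

open MonoidalCategory

/-! Every object `n` is a commutative monoid under `μ_n`, `η_n`, and the monoid on `m + n` is the
tensor product of those on `m` and `n` (`monObj_add`). The heart is `isMonHom_hom`: every morphism
is a monoid homomorphism, by induction on expressions. For `Δ` and `ε` this is the bimonoid axioms,
for `μ` and `S` it needs commutativity.

Coproducts follow by the dual of Fox's theorem. Preservation of units makes `0` initial and lets `f
∨ g` restrict to `f` and `g`. Preservation of products gives `(f ∨ g) ≫ h = (f ≫ h) ∨ (g ≫ h)`; with
`inl ∨ inr = 1` this yields uniqueness of the copairing.

By the universal property, iterated `∨` is a bijection, and it respects convolution because the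
target monoid is commutative. This reduces the group laws to source `1`, where the inverse of `f` is
`f ∘ S`. -/

theorem mk_cast {m n m' n' : ℕ} (hm : m = m') (hn : n = n') (f : Term m n) :
    (Quotient.mk (termSetoid m' n') (f.cast hm hn) : Hom m' n') =
      Hom.cast hm hn (Quotient.mk (termSetoid m n) f) := by
  subst hm hn
  rfl

/-- Equal exponents give isomorphic objects. -/
def congrIso {m n : ℕ} (h : m = n) : (⟨m⟩ : HopfPROP) ≅ ⟨n⟩ :=
  eqToIso (congrArg HopfPROP.mk h)

theorem congrIso_inv {m n : ℕ} (h : m = n) : (congrIso h).inv = (congrIso h.symm).hom := by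
  subst h; rfl

theorem congrIso_trans {l m n : ℕ} (h : l = m) (h' : m = n) :
    (congrIso h).hom ≫ (congrIso h').hom = (congrIso (h.trans h')).hom := by
  subst h h'
  exact Category.comp_id (𝟙 (⟨l⟩ : HopfPROP))

theorem congrIso_trans_assoc {l m n : ℕ} (h : l = m) (h' : m = n) {X : HopfPROP}
    (f : (⟨n⟩ : HopfPROP) ⟶ X) :
    (congrIso h).hom ≫ (congrIso h').hom ≫ f = (congrIso (h.trans h')).hom ≫ f := by
  rw [← Category.assoc, congrIso_trans]

/-- Translates the casts in the strict axioms into composites with coherence isomorphisms. -/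
theorem cast_eq {m n m' n' : ℕ} (hm : m = m') (hn : n = n') (f : Hom m n) :
    (Hom.cast hm hn f : (⟨m'⟩ : HopfPROP) ⟶ ⟨n'⟩) =
      (congrIso hm).inv ≫ (f : (⟨m⟩ : HopfPROP) ⟶ ⟨n⟩) ≫ (congrIso hn).hom := by
  subst hm hn
  have h (g : (⟨m⟩ : HopfPROP) ⟶ ⟨n⟩) : g = 𝟙 _ ≫ g ≫ 𝟙 _ := by simp
  exact h f

instance monoidalStruct : MonoidalCategoryStruct HopfPROP where
  tensorObj X Y := ⟨X.deg + Y.deg⟩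
  tensorUnit := ⟨0⟩
  tensorHom f g := Hom.tensor f g
  whiskerLeft X _ _ f := Hom.tensor (Hom.id X.deg) f
  whiskerRight f Y := Hom.tensor f (Hom.id Y.deg)
  associator X Y Z := congrIso (Nat.add_assoc X.deg Y.deg Z.deg)
  leftUnitor X := congrIso (Nat.zero_add X.deg)
  rightUnitor X := congrIso (Nat.add_zero X.deg)

theorem id_tensorHom_id' (X Y : HopfPROP) : 𝟙 X ⊗ₘ 𝟙 Y = 𝟙 (X ⊗ Y) :=
  Quotient.sound (Rel.tensor_id X.deg Y.deg)

theorem congrIso_tensor {m n m' n' : ℕ} (h : m = n) (h' : m' = n') :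
    (congrIso h).hom ⊗ₘ (congrIso h').hom = (congrIso (congrArg₂ (· + ·) h h')).hom := by
  subst h h'; exact id_tensorHom_id' _ _

instance monoidal : MonoidalCategory HopfPROP :=
  MonoidalCategory.ofTensorHom
    (id_tensorHom_id := id_tensorHom_id')
    (id_tensorHom := fun _ _ _ _ => rfl)
    (tensorHom_id := fun _ _ => rfl)
    (tensorHom_comp_tensorHom := by
      intro X₁ Y₁ Z₁ X₂ Y₂ Z₂ f₁ f₂ g₁ g₂
      induction f₁ using Quotient.inductionOn
      induction f₂ using Quotient.inductionOn
      induction g₁ using Quotient.inductionOn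
      induction g₂ using Quotient.inductionOn
      exact (Quotient.sound (Rel.tensor_comp _ _ _ _)).symm)
    (associator_naturality := by
      intro X₁ X₂ X₃ Y₁ Y₂ Y₃ f g h
      rw [← Iso.inv_comp_eq]
      refine (cast_eq (Nat.add_assoc _ _ _) (Nat.add_assoc _ _ _)
        (Hom.tensor (Hom.tensor f g) h)).symm.trans ?_
      induction f using Quotient.inductionOn
      induction g using Quotient.inductionOn
      induction h using Quotient.inductionOn
      exact (mk_cast _ _ _).symm.trans (Quotient.sound (Rel.tensor_assoc _ _ _)))
    (leftUnitor_naturality := by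
      intro X Y f
      rw [← Iso.inv_comp_eq]
      refine (cast_eq (Nat.zero_add _) (Nat.zero_add _) (Hom.tensor (Hom.id 0) f)).symm.trans ?_
      induction f using Quotient.inductionOn
      exact (mk_cast _ _ _).symm.trans (Quotient.sound (Rel.unit_tensor _)))
    (rightUnitor_naturality := by
      intro X Y f
      rw [← Iso.inv_comp_eq]
      refine (cast_eq (Nat.add_zero _) (Nat.add_zero _) (Hom.tensor f (Hom.id 0))).symm.trans ?_
      induction f using Quotient.inductionOn
      exact (mk_cast _ _ _).symm.trans (Quotient.sound (Rel.tensor_unit _)))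
    (pentagon := fun W X Y Z => by
      have h1 := congrIso_tensor (Nat.add_assoc W.deg X.deg Y.deg) (rfl : Z.deg = Z.deg)
      have h2 := congrIso_tensor (rfl : W.deg = W.deg) (Nat.add_assoc X.deg Y.deg Z.deg)
      refine (congrArg₂ (· ≫ ·) h1 (congrArg (_ ≫ ·) h2)).trans ?_
      refine (congrArg (_ ≫ ·) (congrIso_trans _ _)).trans ?_
      exact (congrIso_trans _ _).trans (congrIso_trans _ _).symm)
    (triangle := fun X Y => by
      have h1 := congrIso_tensor (Nat.add_zero X.deg) (rfl : Y.deg = Y.deg)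
      have h2 := congrIso_tensor (rfl : X.deg = X.deg) (Nat.zero_add Y.deg)
      exact (congrArg (_ ≫ ·) h2).trans ((congrIso_trans _ _).trans h1.symm))

theorem symm_hexagon (X Y Z : HopfPROP) :
    (Hom.symm (X.deg + Y.deg) Z.deg : (X ⊗ Y) ⊗ Z ⟶ Z ⊗ X ⊗ Y) =
      (α_ X Y Z).hom ≫ X ◁ (Hom.symm Y.deg Z.deg : Y ⊗ Z ⟶ Z ⊗ Y) ≫ (α_ X Z Y).inv ≫
        (Hom.symm X.deg Z.deg : X ⊗ Z ⟶ Z ⊗ X) ▷ Y ≫ (α_ Z X Y).hom := by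
  refine (Quotient.sound (Rel.hexagon X.deg Y.deg Z.deg)).trans ?_
  have h1 := (mk_cast (Nat.add_assoc X.deg Y.deg Z.deg).symm
    (Nat.add_assoc X.deg Z.deg Y.deg).symm
    ((Term.id X.deg).tensor (Term.symm Y.deg Z.deg))).trans (cast_eq _ _ _)
  have h2 := (mk_cast rfl (Nat.add_assoc Z.deg X.deg Y.deg)
    ((Term.symm X.deg Z.deg).tensor (Term.id Y.deg))).trans (cast_eq _ _ _)
  refine (congrArg₂ Hom.comp h1 h2).trans ?_
  change ((congrIso _).inv ≫ (X ◁ (Hom.symm Y.deg Z.deg : Y ⊗ Z ⟶ Z ⊗ Y)) ≫ (congrIso _).hom) ≫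
    𝟙 _ ≫ (((Hom.symm X.deg Z.deg : X ⊗ Z ⟶ Z ⊗ X) ▷ Y) ≫ (congrIso _).hom) = _
  rw [congrIso_inv, ← congrIso_inv (Nat.add_assoc X.deg Z.deg Y.deg), Category.id_comp,
    Category.assoc, Category.assoc]
  rfl

/-- The symmetry as an isomorphism. -/
def symmIso (X Y : HopfPROP) : X ⊗ Y ≅ Y ⊗ X where
  hom := Hom.symm X.deg Y.deg
  inv := Hom.symm Y.deg X.deg
  hom_inv_id := Quotient.sound (Rel.symm_symm _ _)
  inv_hom_id := Quotient.sound (Rel.symm_symm _ _)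

theorem symmIso_naturality {X Y X' Y' : HopfPROP} (f : X ⟶ Y) (g : X' ⟶ Y') :
    (f ⊗ₘ g) ≫ (symmIso Y Y').hom = (symmIso X X').hom ≫ (g ⊗ₘ f) := by
  induction f using Quotient.inductionOn
  induction g using Quotient.inductionOn
  exact Quotient.sound (Rel.symm_natural _ _)

theorem symmIso_hexagon (X Y Z : HopfPROP) :
    (α_ X Y Z).inv ≫ (symmIso (X ⊗ Y) Z).hom ≫ (α_ Z X Y).inv =
      (X ◁ (symmIso Y Z).hom) ≫ (α_ X Z Y).inv ≫ ((symmIso X Z).hom ▷ Y) := by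
  rw [Iso.inv_comp_eq, ← Category.assoc, Iso.comp_inv_eq]
  simp only [Category.assoc]
  exact symm_hexagon X Y Z

instance symmetric : SymmetricCategory HopfPROP where
  braiding := symmIso
  braiding_naturality_right X _ _ f := symmIso_naturality (𝟙 X) f
  braiding_naturality_left f Z := symmIso_naturality f (𝟙 Z)
  hexagon_forward X Y Z := by
    -- As the symmetry is involutive, this hexagon is the inverse of the other one with its objects
    -- cyclically permuted.
    let e := (α_ Y Z X).symm ≪≫ symmIso (Y ⊗ Z) X ≪≫ (α_ X Y Z).symm
    let e' := whiskerLeftIso Y (symmIso Z X) ≪≫ (α_ Y X Z).symm ≪≫ whiskerRightIso (symmIso Y X) Z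
    have h : e.inv = e'.inv := congrArg Iso.inv (Iso.ext (symmIso_hexagon Y Z X))
    simp only [e, e', Iso.trans_inv, Iso.symm_inv, Category.assoc] at h
    exact h
  hexagon_reverse := symmIso_hexagon
  symmetry X Y := (symmIso X Y).hom_inv_id

/-! ### The generator as a commutative Hopf monoid -/

open MonObj ComonObj HopfObj

theorem whiskerLeft_congrIso (X : HopfPROP) {m n : ℕ} (h : m = n) :
    X ◁ (congrIso h).hom = (congrIso (congrArg (X.deg + ·) h)).hom := by
  subst h; exact whiskerLeft_id _ _

theorem associator_eq (X Y Z : HopfPROP) :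
    α_ X Y Z = congrIso (Nat.add_assoc X.deg Y.deg Z.deg) := rfl

/-- All associators are `congrIso`s, so they merge and leave the middle symmetry in the form used by
`mulPow` and `comulPow`. -/
theorem tensorμ_eq (a b c d : ℕ) :
    tensorμ (⟨a⟩ : HopfPROP) ⟨b⟩ ⟨c⟩ ⟨d⟩ =
      (congrIso (show (a + b) + (c + d) = a + (b + c) + d by omega)).hom ≫
        ((⟨a⟩ : HopfPROP) ◁ (β_ (⟨b⟩ : HopfPROP) ⟨c⟩).hom) ▷ ⟨d⟩ ≫
        (congrIso (show a + (c + b) + d = (a + c) + (b + d) by omega)).hom := by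
  rw [whisker_assoc]
  simp only [tensorμ, associator_eq, congrIso_inv, Category.assoc, whiskerLeft_congrIso,
    congrIso_trans]
  erw [congrIso_trans_assoc, congrIso_trans_assoc]

theorem id_comp_eq {m n : ℕ} (f : Hom m n) : Hom.comp (Hom.id m) f = f :=
  Category.id_comp (X := (⟨m⟩ : HopfPROP)) (Y := ⟨n⟩) f

theorem comp_id_eq {m n : ℕ} (f : Hom m n) : Hom.comp f (Hom.id n) = f :=
  Category.comp_id (X := (⟨m⟩ : HopfPROP)) (Y := ⟨n⟩) f

instance monObjOne : MonObj (⟨1⟩ : HopfPROP) where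
  one := Hom.unit
  mul := Hom.mul
  one_mul := Quotient.sound Rel.unit_mul
  mul_one := Quotient.sound Rel.mul_unit
  mul_assoc := (Quotient.sound Rel.mul_assoc).trans (id_comp_eq _).symm

instance comonObjOne : ComonObj (⟨1⟩ : HopfPROP) where
  counit := Hom.counit
  comul := Hom.comul
  counit_comul := Quotient.sound Rel.counit_comul
  comul_counit := Quotient.sound Rel.comul_counit
  comul_assoc := (Quotient.sound Rel.comul_assoc).symm.trans
    (congrArg (Hom.comp Hom.comul) (comp_id_eq (Hom.tensor Hom.comul (Hom.id 1))).symm)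

instance isCommMonObjOne : IsCommMonObj (⟨1⟩ : HopfPROP) where
  mul_comm := Quotient.sound Rel.mul_comm

theorem tensorμ_one :
    tensorμ (⟨1⟩ : HopfPROP) ⟨1⟩ ⟨1⟩ ⟨1⟩ =
      Hom.tensor (Hom.tensor (Hom.id 1) (Hom.symm 1 1)) (Hom.id 1) :=
  (tensorμ_eq 1 1 1 1).trans ((id_comp_eq _).trans (comp_id_eq _))

instance hopfObjOne : HopfObj (⟨1⟩ : HopfPROP) where
  mul_comul := by
    rw [tensorμ_one]
    exact Quotient.sound Rel.mul_comul
  one_comul := (Quotient.sound Rel.unit_comul).trans (id_comp_eq _).symm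
  mul_counit := (Quotient.sound Rel.mul_counit).trans (comp_id_eq _).symm
  one_counit := Quotient.sound Rel.unit_counit
  antipode := Hom.antipode
  antipode_left := Quotient.sound Rel.antipode_left
  antipode_right := Quotient.sound Rel.antipode_right

/-! ### Monoid structures on the tensor powers -/

/-- The monoid structure on the `n`-th tensor power of the generator. -/
@[reducible]
def monObj : (n : ℕ) → MonObj (⟨n⟩ : HopfPROP)
  | 0 => inferInstanceAs (MonObj (𝟙_ HopfPROP))
  | n + 1 =>
    letI := monObj n
    inferInstanceAs (MonObj ((⟨n⟩ : HopfPROP) ⊗ ⟨1⟩))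

theorem monObj_one (n : ℕ) : (monObj n).one = Hom.unitPow n := by
  induction n with
  | zero => rfl
  | succ n ih => exact (id_comp_eq _).trans (congrArg (Hom.tensor · Hom.unit) ih)

theorem mulPow_succ (n : ℕ) :
    Hom.mulPow (n + 1) = tensorμ (⟨n⟩ : HopfPROP) ⟨1⟩ ⟨n⟩ ⟨1⟩ ≫
      ((Hom.mulPow n : (⟨n⟩ : HopfPROP) ⊗ ⟨n⟩ ⟶ ⟨n⟩) ⊗ₘ Hom.mul) := by
  rw [tensorμ_eq]
  exact congrArg (Hom.comp · _) (cast_eq _ _ _)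

theorem comulPow_succ (n : ℕ) :
    Hom.comulPow (n + 1) =
      ((Hom.comulPow n : (⟨n⟩ : HopfPROP) ⟶ ⟨n⟩ ⊗ ⟨n⟩) ⊗ₘ Δ[(⟨1⟩ : HopfPROP)]) ≫
        tensorμ (⟨n⟩ : HopfPROP) ⟨n⟩ ⟨1⟩ ⟨1⟩ := by
  rw [tensorμ_eq]
  exact congrArg (Hom.comp _) (cast_eq _ _ _)

theorem monObj_mul (n : ℕ) : (monObj n).mul = Hom.mulPow n := by
  induction n with
  | zero => rfl
  | succ n ih =>
    rw [mulPow_succ, ← ih]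
    rfl

theorem isCommMonObj (n : ℕ) : @IsCommMonObj _ _ _ _ (⟨n⟩ : HopfPROP) (monObj n) := by
  induction n with
  | zero => exact inferInstanceAs (IsCommMonObj (𝟙_ HopfPROP))
  | succ n ih =>
    let := monObj n
    exact inferInstanceAs (IsCommMonObj ((⟨n⟩ : HopfPROP) ⊗ ⟨1⟩))

/-- Applied to unitors and associators that are definitionally identities, this turns coherence of
tensor products of monoids into equality of structures. -/
theorem monObj_eq_of_isMonHom_id {C : Type*} [Category* C] [MonoidalCategory C] {X : C}
    (i j : MonObj X) (h : @IsMonHom _ _ _ X X i j (𝟙 X)) : i = j := by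
  refine MonObj.ext _ _ ?_
  have := h.mul_hom
  simpa using this

theorem monObj_one_eq : monObj 1 = monObjOne :=
  monObj_eq_of_isMonHom_id _ _
    (inferInstanceAs (IsMonHom (λ_ (⟨1⟩ : HopfPROP)).hom))

/-- The tensor product of two monoid structures. -/
@[reducible]
def tensorMonObj {C : Type*} [Category* C] [MonoidalCategory C] [BraidedCategory C] {X Y : C}
    (i : MonObj X) (j : MonObj Y) : MonObj (X ⊗ Y) :=
  MonObj.tensorObj.instTensorObj

section

variable {C : Type*} [Category* C] [MonoidalCategory C] [BraidedCategory C] {X Y Z : C}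

theorem isMonHom_rightUnitor (i : MonObj X) :
    @IsMonHom _ _ _ _ _ (tensorMonObj i (inferInstanceAs (MonObj (𝟙_ C)))) i (ρ_ X).hom :=
  ⟨one_rightUnitor, mul_rightUnitor⟩

theorem isMonHom_associator (i : MonObj X) (j : MonObj Y) (k : MonObj Z) :
    @IsMonHom _ _ _ _ _ (tensorMonObj (tensorMonObj i j) k) (tensorMonObj i (tensorMonObj j k))
      (α_ X Y Z).hom :=
  ⟨one_associator, mul_associator⟩

end

theorem monObj_add (m n : ℕ) : monObj (m + n) = tensorMonObj (monObj m) (monObj n) := by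
  induction n with
  | zero => exact (monObj_eq_of_isMonHom_id _ _ (isMonHom_rightUnitor (monObj m))).symm
  | succ n ih =>
    -- Since `m + (n + 1)` unfolds to `(m + n) + 1`, the associator here is an identity.
    exact (congrArg (tensorMonObj · monObjOne) ih).trans (monObj_eq_of_isMonHom_id _ _
      (isMonHom_associator (monObj m) (monObj n) monObjOne))

theorem monObj_two : monObj 2 = tensorMonObj monObjOne monObjOne :=
  congrArg (tensorMonObj · monObjOne) monObj_one_eq

/-! ### Every morphism is a monoid homomorphism -/

section

variable {C : Type*} [Category* C] [MonoidalCategory C]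

theorem isMonHom_one (M : C) [MonObj M] : IsMonHom η[M] where
  mul_hom := by simp [unitors_equal]

variable [BraidedCategory C]

theorem isMonHom_mul (M : C) [MonObj M] [IsCommMonObj M] : IsMonHom μ[M] where
  one_hom := by simp [MonObj.tensorObj.one_def, ← unitors_equal]
  mul_hom := by simp [MonObj.tensorObj.mul_def]

theorem isMonHom_counit (M : C) [BimonObj M] : IsMonHom ε[M] where

theorem isMonHom_comul (M : C) [BimonObj M] : IsMonHom Δ[M] where
  one_hom := by simp
  mul_hom := by simp [MonObj.tensorObj.mul_def]

end

/-- The antipode reverses products; commutativity removes the reversal. -/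
theorem isMonHom_antipode {C : Type*} [Category* C] [MonoidalCategory C] [SymmetricCategory C]
    (M : C) [HopfObj M] [IsCommMonObj M] : IsMonHom 𝒮[M] where
  one_hom := HopfObj.one_antipode M
  mul_hom := by simpa using HopfObj.mul_antipode M

theorem isMonHom_hom {m n : ℕ} (f : Hom m n) :
    @IsMonHom _ _ _ (⟨m⟩ : HopfPROP) ⟨n⟩ (monObj m) (monObj n) f := by
  induction f using Quotient.inductionOn with | _ f
  induction f with
  | @id n =>
    let := monObj n
    exact inferInstanceAs (IsMonHom (𝟙 (⟨n⟩ : HopfPROP)))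
  | @comp l m n f g hf hg =>
    exact @instIsMonHomComp HopfPROP _ _ ⟨l⟩ ⟨m⟩ ⟨n⟩ (monObj l) (monObj m) (monObj n) _ _ hf hg
  | @tensor m n m' n' f g hf hg =>
    rw [monObj_add, monObj_add]
    let := monObj m
    let := monObj n
    let := monObj m'
    let := monObj n'
    let F : (⟨m⟩ : HopfPROP) ⟶ ⟨n⟩ := Quotient.mk _ f
    let G : (⟨m'⟩ : HopfPROP) ⟶ ⟨n'⟩ := Quotient.mk _ g
    have : IsMonHom F := hf
    have : IsMonHom G := hg
    exact inferInstanceAs (IsMonHom (F ⊗ₘ G))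
  | symm m n =>
    rw [monObj_add, monObj_add]
    let := monObj m
    let := monObj n
    exact inferInstanceAs (IsMonHom (β_ (⟨m⟩ : HopfPROP) ⟨n⟩).hom)
  | mul => rw [monObj_two, monObj_one_eq]; exact isMonHom_mul (⟨1⟩ : HopfPROP)
  | unit => rw [monObj_one_eq]; exact isMonHom_one (⟨1⟩ : HopfPROP)
  | comul => rw [monObj_two, monObj_one_eq]; exact isMonHom_comul (⟨1⟩ : HopfPROP)
  | counit => rw [monObj_one_eq]; exact isMonHom_counit (⟨1⟩ : HopfPROP)
  | antipode => rw [monObj_one_eq]; exact isMonHom_antipode (⟨1⟩ : HopfPROP)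

/-! ### Coproducts -/

section

variable {C : Type*} [Category* C] [MonoidalCategory C]

theorem inl_vee {X Y N : C} [MonObj N] (u : 𝟙_ C ⟶ Y) (f : X ⟶ N) (g : Y ⟶ N) (h : u ≫ g = η) :
    ((ρ_ X).inv ≫ (𝟙 X ⊗ₘ u)) ≫ (f ⊗ₘ g) ≫ μ = f := by
  rw [Category.assoc, tensorHom_comp_tensorHom_assoc, h]
  simp

theorem inr_vee {X Y N : C} [MonObj N] (u : 𝟙_ C ⟶ X) (f : X ⟶ N) (g : Y ⟶ N) (h : u ≫ f = η) :
    ((λ_ Y).inv ≫ (u ⊗ₘ 𝟙 Y)) ≫ (f ⊗ₘ g) ≫ μ = g := by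
  rw [Category.assoc, tensorHom_comp_tensorHom_assoc, h]
  simp

variable [BraidedCategory C]

/-- After the middle interchange, each factor contains a multiplication by a unit, which cancels. -/
theorem inl_tensor_inr_mul (X Y : C) [MonObj X] [MonObj Y] :
    (((ρ_ X).inv ≫ (𝟙 X ⊗ₘ η[Y])) ⊗ₘ ((λ_ Y).inv ≫ (η[X] ⊗ₘ 𝟙 Y))) ≫ μ[X ⊗ Y] = 𝟙 (X ⊗ Y) := by
  rw [MonObj.tensorObj.mul_def, ← tensorHom_comp_tensorHom]
  simp only [Category.assoc]
  rw [tensorμ_natural_assoc, tensorHom_comp_tensorHom]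
  rw [mul_one_hom, one_mul_hom]
  simp only [tensorμ, braiding_tensorUnit_left, Category.comp_id]
  monoidal

/-- The law `(ab)(cd) = (ac)(bd)` in the commutative monoid `N`, combined with naturality of the
interchange. -/
theorem convolution_vee {X Y N P Q P' Q' : C} [MonObj N] [IsCommMonObj N]
    (d : X ⟶ P ⊗ P') (e : Y ⟶ Q ⊗ Q')
    (f : P ⟶ N) (g : Q ⟶ N) (f' : P' ⟶ N) (g' : Q' ⟶ N) :
    ((d ⊗ₘ e) ≫ tensorμ P P' Q Q') ≫ (((f ⊗ₘ g) ≫ μ) ⊗ₘ ((f' ⊗ₘ g') ≫ μ)) ≫ μ =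
      ((d ≫ (f ⊗ₘ f') ≫ μ) ⊗ₘ (e ≫ (g ⊗ₘ g') ≫ μ)) ≫ μ := by
  rw [← tensorHom_comp_tensorHom, ← tensorHom_comp_tensorHom, ← tensorHom_comp_tensorHom]
  simp only [Category.assoc]
  rw [← tensorμ_natural_assoc, MonObj.mul_mul_mul_comm]

end

theorem unitPow_comp {m n : ℕ} (f : Hom m n) : (Hom.unitPow m).comp f = Hom.unitPow n := by
  rw [← monObj_one, ← monObj_one]
  exact (isMonHom_hom f).one_hom

theorem mulPow_comp {m n : ℕ} (f : Hom m n) :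
    (Hom.mulPow m).comp f = (Hom.tensor f f).comp (Hom.mulPow n) := by
  rw [← monObj_mul, ← monObj_mul]
  exact (isMonHom_hom f).mul_hom

theorem hom_inl_eq (m m' : ℕ) :
    Hom.inl m m' = (ρ_ (⟨m⟩ : HopfPROP)).inv ≫
      (𝟙 (⟨m⟩ : HopfPROP) ⊗ₘ (Hom.unitPow m' : 𝟙_ HopfPROP ⟶ ⟨m'⟩)) :=
  (cast_eq _ _ _).trans (congrArg (Hom.comp _) (comp_id_eq _))

theorem hom_inr_eq (m m' : ℕ) :
    Hom.inr m m' = (λ_ (⟨m'⟩ : HopfPROP)).inv ≫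
      ((Hom.unitPow m : 𝟙_ HopfPROP ⟶ ⟨m⟩) ⊗ₘ 𝟙 (⟨m'⟩ : HopfPROP)) :=
  (cast_eq _ _ _).trans (congrArg (Hom.comp _) (comp_id_eq _))

theorem vee_eq {m m' n : ℕ} (f : Hom m n) (g : Hom m' n) :
    Hom.vee f g = ((f : (⟨m⟩ : HopfPROP) ⟶ ⟨n⟩) ⊗ₘ (g : (⟨m'⟩ : HopfPROP) ⟶ ⟨n⟩)) ≫
      (monObj n).mul := by
  rw [monObj_mul]; rfl

theorem hom_inl_comp_vee {m m' n : ℕ} (f : Hom m n) (g : Hom m' n) :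
    (Hom.inl m m').comp (Hom.vee f g) = f := by
  rw [hom_inl_eq, vee_eq]
  let := monObj n
  exact inl_vee (C := HopfPROP) (X := ⟨m⟩) (Y := ⟨m'⟩) (N := ⟨n⟩) _ f g
    ((unitPow_comp g).trans (monObj_one n).symm)

theorem hom_inr_comp_vee {m m' n : ℕ} (f : Hom m n) (g : Hom m' n) :
    (Hom.inr m m').comp (Hom.vee f g) = g := by
  rw [hom_inr_eq, vee_eq]
  let := monObj n
  exact inr_vee (C := HopfPROP) (X := ⟨m⟩) (Y := ⟨m'⟩) (N := ⟨n⟩) _ f g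
    ((unitPow_comp f).trans (monObj_one n).symm)

theorem vee_inl_inr (m m' : ℕ) : (Hom.inl m m').vee (Hom.inr m m') = Hom.id (m + m') := by
  rw [hom_inl_eq, hom_inr_eq, vee_eq, monObj_add, ← monObj_one, ← monObj_one]
  exact @inl_tensor_inr_mul HopfPROP _ _ _ ⟨m⟩ ⟨m'⟩ (monObj m) (monObj m')

theorem vee_comp {m m' n k : ℕ} (f : Hom m n) (g : Hom m' n) (h : Hom n k) :
    (f.vee g).comp h = (f.comp h).vee (g.comp h) := by
  let F : (⟨m⟩ : HopfPROP) ⟶ ⟨n⟩ := f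
  let G : (⟨m'⟩ : HopfPROP) ⟶ ⟨n⟩ := g
  let H : (⟨n⟩ : HopfPROP) ⟶ ⟨k⟩ := h
  let M : (⟨n⟩ : HopfPROP) ⊗ ⟨n⟩ ⟶ ⟨n⟩ := Hom.mulPow n
  let M' : (⟨k⟩ : HopfPROP) ⊗ ⟨k⟩ ⟶ ⟨k⟩ := Hom.mulPow k
  have e : M ≫ H = (H ⊗ₘ H) ≫ M' := mulPow_comp h
  change ((F ⊗ₘ G) ≫ M) ≫ H = ((F ≫ H) ⊗ₘ (G ≫ H)) ≫ M'
  rw [Category.assoc, e, tensorHom_comp_tensorHom_assoc]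

theorem eq_vee {m m' n : ℕ} (h : Hom (m + m') n) :
    h = ((Hom.inl m m').comp h).vee ((Hom.inr m m').comp h) := by
  rw [← vee_comp, vee_inl_inr, id_comp_eq]

/-- The object `0` is initial. -/
def isInitialZero : IsInitial (⟨0⟩ : HopfPROP) :=
  IsInitial.ofUniqueHom (fun X => Hom.unitPow X.deg) fun _ f =>
    (id_comp_eq f).symm.trans (unitPow_comp f)

/-- The object `m + m'` is a coproduct of `m` and `m'`. -/
def isColimitBinaryCofan (m m' : ℕ) :
    IsColimit (BinaryCofan.mk (HopfPROP.inl m m') (HopfPROP.inr m m')) :=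
  BinaryCofan.IsColimit.mk _ (fun f g => Hom.vee f g) (fun f g => hom_inl_comp_vee f g)
    (fun f g => hom_inr_comp_vee f g) fun f g h hf hg => by
      subst hf hg
      exact eq_vee h

theorem hasFiniteCoproducts : HasFiniteCoproducts HopfPROP := by
  have : HasInitial HopfPROP := isInitialZero.hasInitial
  have : HasBinaryCoproducts HopfPROP := by
    have (X Y : HopfPROP) : HasColimit (pair X Y) := ⟨⟨_, isColimitBinaryCofan X.deg Y.deg⟩⟩
    exact hasBinaryCoproducts_of_hasColimit_pair _
  exact hasFiniteCoproducts_of_has_binary_and_initial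

/-! ### Convolution -/

theorem comulPow_one : Hom.comulPow 1 = Hom.comul := by
  have h : tensorμ (⟨0⟩ : HopfPROP) ⟨0⟩ ⟨1⟩ ⟨1⟩ = Hom.id 2 := by
    rw [tensorμ_eq]
    have : β_ (⟨0⟩ : HopfPROP) ⟨1⟩ = Iso.refl _ := by
      ext
      exact (braiding_tensorUnit_left (⟨1⟩ : HopfPROP)).trans (Category.comp_id _)
    rw [this, Iso.refl_hom, MonoidalCategory.whiskerLeft_id]
    exact (id_comp_eq _).trans ((comp_id_eq _).trans (id_whiskerRight _ _))
  rw [comulPow_succ, h]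
  exact (comp_id_eq _).trans (Quotient.sound (Rel.unit_tensor Term.comul))

theorem counitPow_one : Hom.counitPow 1 = Hom.counit :=
  Quotient.sound (Rel.unit_tensor Term.counit)

/-- The convolution product, on unbundled morphisms. -/
def convolution {m n : ℕ} (f g : Hom m n) : Hom m n :=
  (Hom.comulPow m).comp ((Hom.tensor f g).comp (Hom.mulPow n))

theorem convolution_vee_vee {m n : ℕ} (f f' : Hom m n) (g g' : Hom 1 n) :
    convolution (f.vee g) (f'.vee g') = (convolution f f').vee (convolution g g') := by
  unfold convolution
  rw [comulPow_succ, comulPow_one, vee_eq, vee_eq, vee_eq, ← monObj_mul]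
  let := monObj n
  have := isCommMonObj n
  exact convolution_vee (C := HopfPROP) (X := ⟨m⟩) (Y := ⟨1⟩) (N := ⟨n⟩) (P := ⟨m⟩) (P' := ⟨m⟩)
    (Q := ⟨1⟩) (Q' := ⟨1⟩) (Hom.comulPow m) Hom.comul f g f' g'

theorem iteratedVee_convolution {n : ℕ} (m : ℕ) (v w : Fin m → Hom 1 n) :
    Hom.iteratedVee m (fun i => convolution (v i) (w i)) =
      convolution (Hom.iteratedVee m v) (Hom.iteratedVee m w) := by
  induction m with
  | zero => exact isInitialZero.hom_ext (Y := ⟨n⟩) _ _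
  | succ m ih =>
    exact (congrArg (Hom.vee · _) (ih _ _)).trans (convolution_vee_vee _ _ _ _).symm

theorem iteratedVee_counit_unitPow {n : ℕ} (m : ℕ) :
    Hom.iteratedVee m (fun _ => (Hom.counitPow 1).comp (Hom.unitPow n)) =
      (Hom.counitPow m).comp (Hom.unitPow n) := by
  induction m with
  | zero => exact isInitialZero.hom_ext (Y := ⟨n⟩) _ _
  | succ m ih =>
    refine (congrArg (Hom.vee · _) ih).trans ?_
    rw [counitPow_one, vee_eq, ← monObj_one]
    let := monObj n
    have h {X Y N : HopfPROP} [MonObj N] (f : X ⟶ 𝟙_ _) (g : Y ⟶ 𝟙_ _) :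
        ((f ≫ η[N]) ⊗ₘ (g ≫ η[N])) ≫ μ = (f ⊗ₘ g) ≫ (λ_ _).hom ≫ η[N] := by
      rw [← tensorHom_comp_tensorHom, Category.assoc, one_mul_hom]
    refine (h (N := ⟨n⟩) (X := ⟨m⟩) (Y := ⟨1⟩) (Hom.counitPow m) Hom.counit).trans ?_
    exact congrArg (Hom.comp _) (id_comp_eq _)

/-- Induction along the coproduct `m + 1`: a morphism out of it is determined by its two
restrictions, which are arbitrary. -/
theorem iteratedVee_bijective (m n : ℕ) :
    Function.Bijective (Hom.iteratedVee m : (Fin m → Hom 1 n) → Hom m n) := by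
  induction m with
  | zero => exact ⟨fun _ _ _ => Subsingleton.elim _ _,
      fun f => ⟨Fin.elim0, isInitialZero.hom_ext (Y := ⟨n⟩) _ _⟩⟩
  | succ m ih =>
    constructor
    · intro v w h
      have hl := congrArg (Hom.comp (Hom.inl m 1)) h
      have hr := congrArg (Hom.comp (Hom.inr m 1)) h
      simp only [Hom.iteratedVee, hom_inl_comp_vee, hom_inr_comp_vee] at hl hr
      funext i
      induction i using Fin.lastCases with
      | last => exact hr
      | cast i => exact congrFun (ih.1 hl) i
    · intro h
      obtain ⟨w, hw⟩ := ih.2 ((Hom.inl m 1).comp h)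
      refine ⟨Fin.snoc (α := fun _ => Hom 1 n) w ((Hom.inr m 1).comp h), ?_⟩
      simp only [Hom.iteratedVee, Fin.snoc_castSucc, Fin.snoc_last, hw]
      exact (eq_vee h).symm

section

variable {n : ℕ}

/-- Gives associativity and unitality for source `1` from the general convolution monoid of a
comonoid and a monoid. -/
theorem convolution_eq (f g : CategoryTheory.Conv (⟨1⟩ : HopfPROP) ⟨n⟩) :
    letI := monObj n
    convolution f g = f * g := by
  unfold convolution
  rw [comulPow_one, ← monObj_mul]
  let := monObj n
  exact congrArg (Δ ≫ ·) (MonoidalCategory.tensorHom_def_assoc (C := HopfPROP)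
    (X₁ := ⟨1⟩) (Y₁ := ⟨n⟩) (X₂ := ⟨1⟩) (Y₂ := ⟨n⟩) f g μ)

theorem counitPow_comp_unitPow_eq :
    letI := monObj n
    (Hom.counitPow 1).comp (Hom.unitPow n) = (1 : CategoryTheory.Conv (⟨1⟩ : HopfPROP) ⟨n⟩) := by
  rw [counitPow_one, ← monObj_one]
  rfl

/-- Composing with the monoid homomorphism `f` carries `S * 1 = ηε` to the required identity. -/
theorem convolution_antipode_comp (f : Hom 1 n) :
    convolution (Hom.antipode.comp f) f = (Hom.counitPow 1).comp (Hom.unitPow n) := by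
  refine (convolution_eq _ _).trans (Eq.trans ?_ counitPow_comp_unitPow_eq.symm)
  let := monObj n
  let F : (⟨1⟩ : HopfPROP) ⟶ ⟨n⟩ := f
  have : IsMonHom F := monObj_one_eq ▸ isMonHom_hom f
  change Δ ≫ (𝒮 ≫ F) ▷ _ ≫ _ ◁ F ≫ μ = ε ≫ η
  rw [comp_whiskerRight_assoc, ← MonoidalCategory.tensorHom_def_assoc, ← IsMonHom.mul_hom,
    HopfObj.antipode_left_assoc, IsMonHom.one_hom]

end

theorem conv_one_mul_assoc {n : ℕ} (f g h : Conv 1 n) : f * g * h = f * (g * h) := by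
  let := monObj n
  let F : CategoryTheory.Conv (⟨1⟩ : HopfPROP) ⟨n⟩ := f
  let G : CategoryTheory.Conv (⟨1⟩ : HopfPROP) ⟨n⟩ := g
  let H : CategoryTheory.Conv (⟨1⟩ : HopfPROP) ⟨n⟩ := h
  change convolution (convolution F G) H = convolution F (convolution G H)
  rw [convolution_eq F G, convolution_eq G H, convolution_eq, convolution_eq, _root_.mul_assoc]

theorem conv_one_one_mul {n : ℕ} (f : Conv 1 n) : 1 * f = f := by
  let := monObj n
  let F : CategoryTheory.Conv (⟨1⟩ : HopfPROP) ⟨n⟩ := f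
  change convolution ((Hom.counitPow 1).comp (Hom.unitPow n)) F = F
  rw [counitPow_comp_unitPow_eq, convolution_eq, _root_.one_mul]

/-- The group of morphisms `1 → n` for convolution. -/
@[reducible]
def convGroupOne (n : ℕ) : Group (Conv 1 n) :=
  letI : Inv (Conv 1 n) := ⟨fun f => Hom.antipode.comp f⟩
  Group.ofLeftAxioms conv_one_mul_assoc conv_one_one_mul fun f => convolution_antipode_comp f

/-- Convolution of morphisms `m → n` corresponds to componentwise convolution of families. -/
noncomputable def convEquiv (m n : ℕ) : Conv m n ≃* (Fin m → Conv 1 n) :=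
  MulEquiv.symm
    { Equiv.ofBijective _ (iteratedVee_bijective m n) with
      map_mul' := iteratedVee_convolution m }

theorem convEquiv_symm_apply (m n : ℕ) (w : Fin m → Conv 1 n) :
    (convEquiv m n).symm w = Hom.iteratedVee m w := rfl

theorem convEquiv_one (m n : ℕ) : convEquiv m n 1 = 1 :=
  (MulEquiv.symm_apply_eq _).1 (iteratedVee_counit_unitPow m) |>.symm

/-- The group of morphisms `m → n` for convolution. -/
@[reducible]
noncomputable def convGroup (m n : ℕ) : Group (Conv m n) :=
  letI := convGroupOne n
  -- Only the inverse is transported; product and unit stay the given convolution ones, and the laws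
  -- are checked after applying `convEquiv`.
  letI : Inv (Conv m n) := ⟨fun f => (convEquiv m n).symm (convEquiv m n f)⁻¹⟩
  Group.ofLeftAxioms
    (fun f g h => (convEquiv m n).injective <| by
      rw [map_mul, map_mul, map_mul, map_mul]
      exact _root_.mul_assoc (G := Fin m → Conv 1 n) _ _ _)
    (fun f => (convEquiv m n).injective <| by
      rw [map_mul, convEquiv_one]
      exact _root_.one_mul (M := Fin m → Conv 1 n) _)
    (fun f => (convEquiv m n).injective <| by
      rw [map_mul, convEquiv_one]
      refine (congrArg (· * _) (MulEquiv.apply_symm_apply _ _)).trans ?_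
      exact inv_mul_cancel (G := Fin m → Conv 1 n) _)

end HopfPROP

theorem proposition6p2 :
    -- finite coproducts exist, the object `0` is initial, and `m + m'` is a coproduct
    HasFiniteCoproducts HopfPROP ∧
    Nonempty (IsInitial (⟨0⟩ : HopfPROP)) ∧
    (∀ m m' : ℕ, Nonempty (IsColimit
      (BinaryCofan.mk (HopfPROP.inl m m') (HopfPROP.inr m m')))) ∧
    -- convolution makes every set of morphisms a group
    (∀ m n : ℕ, ∃ G : Group (HopfPROP.Conv m n),
      G.toMul = HopfPROP.convMul m n ∧ G.toOne = HopfPROP.convOne m n) ∧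
    -- the iterated operation `∨` is an isomorphism of groups for convolution
    (∀ m n : ℕ, ∃ e : HopfPROP.Conv m n ≃* (Fin m → HopfPROP.Conv 1 n),
      ∀ w : Fin m → HopfPROP.Conv 1 n, e.symm w = HopfPROP.Hom.iteratedVee m w) :=
  ⟨HopfPROP.hasFiniteCoproducts, ⟨HopfPROP.isInitialZero⟩,
    fun m m' => ⟨HopfPROP.isColimitBinaryCofan m m'⟩,
    fun m n => ⟨HopfPROP.convGroup m n, rfl, rfl⟩,
    fun m n => ⟨HopfPROP.convEquiv m n, HopfPROP.convEquiv_symm_apply m n⟩⟩
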